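/- \textbf{Setting.} For $p\in(0,1)$ let $X_1,X_2,\dots$ be i.i.d. Bernoulli random variables with parameter $p$, and let $U_1,U_2,\dots$ be i.i.d. random variables uniformly distributed on $(0,1)$ and independent of the $X_i$. A (possibly randomized) sequential algorithm consists of measurable functions $\tau_n,\gamma_n:(\{0,1\}\times\mathbb R)^n\to\{0,1\}$, $n\ge 1$, not depending on $p$. Its stopping time is $$N=\min\{n\ge 1:\ \tau_n(X_1,U_1;\dots;X_n,U_n)=1\}$$ ($N=\infty$ if there is no such $n$), and its output is $Y=\gamma_N(X_1,U_1;\dots;X_N,U_N)$ when $N<\infty$. (The algorithm is non-randomized if $\tau_n,\gamma_n$ do not depend on the $U_i$.) For $S\subseteq(0,1)$ and $f:S\to(0,1)$, the algorithm is a Bernoulli factory for $f$ if, for every $p\in S$, $N$ is almost surely finite and $Y$ is a Bernoulli variable with parameter $f(p)$. It is fast if for every $p\in S$ there are $A>0$ and $\beta<1$, possibly depending on $p$, such that $\Pr[N>n]\le A\beta^n$ for all integers $n\ge 0$. \textbf{Theorem.} Let $S\subseteq(0,1)$ be open and let $f:S\to(0,1)$ be differentiable. Then every fast, possibly randomized,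 Bernoulli factory for $f$ satisfies, for all $p\in S$, $$\mathbb E[N]\ \ge\ \bigl(f'(p)\bigr)^2\,\frac{p(1-p)}{f(p)\,(1-f(p))},$$ where $\mathbb E[N]$ is the expected number of inputs when the input sequence has parameter $p$. -/

import Mathlib

open MeasureTheory ProbabilityTheory
open scoped ENNReal unitInterval

namespace BernoulliFactory

/-- The uniform distribution on `(0,1)`. -/
noncomputable def uniform01 : Measure ℝ := volume.restrict (Set.Ioo (0 : ℝ) 1)

instance : IsProbabilityMeasure uniform01 :=
  ⟨by simp [uniform01]⟩

/-- The joint law of the i.i.d. sequence of pairs `(X_i, U_i)`: `X_i` is Bernoulli with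
parameter `p` (`true` is the value `1`, `false` is the value `0`), `U_i` is uniform on `(0,1)`,
and all these variables are independent. The coordinate `ω i` of a sample point
`ω : ℕ → Bool × ℝ` is the pair number `i + 1`. -/
noncomputable def inputLaw (p : I) : Measure (ℕ → Bool × ℝ) :=
  Measure.infinitePi fun _ : ℕ => (bernoulliMeasure true false p).prod uniform01

/-- The first `n` pairs `(x_1, u_1), …, (x_n, u_n)` of a realization. -/
def initial (ω : ℕ → Bool × ℝ) (n : ℕ) : Fin n → Bool × ℝ := fun i => ω i

/-- A (possibly randomized) sequential algorithm producing one bit: measurable stopping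
functions `τ_n` and measurable output functions `γ_n` of `(x_1, u_1), …, (x_n, u_n)`. Only the
indices `n ≥ 1` are used. The algorithm is non-randomized if these functions ignore the `u_i`. -/
structure Algorithm where
  /-- the stopping functions `τ_n` (`true` means: halt here) -/
  tau : (n : ℕ) → (Fin n → Bool × ℝ) → Bool
  /-- the output functions `γ_n` -/
  gamma : (n : ℕ) → (Fin n → Bool × ℝ) → Bool
  measurable_tau : ∀ n, Measurable (tau n)
  measurable_gamma : ∀ n, Measurable (gamma n)

namespace Algorithm

/-- The stopping time `N`: the smallest `n ≥ 1` with `τ_n = 1`, or `∞` if there is none. -/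
noncomputable def stopTime (B : Algorithm) (ω : ℕ → Bool × ℝ) : ℕ∞ :=
  ⨅ (n : ℕ) (_ : 1 ≤ n ∧ B.tau n (initial ω n) = true), (n : ℕ∞)

/-- The output `Y = γ_N(X_1, U_1; …; X_N, U_N)`. On the event `N = ∞`, which has probability `0`
for a Bernoulli factory, the value is irrelevant. -/
noncomputable def output (B : Algorithm) (ω : ℕ → Bool × ℝ) : Bool :=
  B.gamma (B.stopTime ω).toNat (initial ω (B.stopTime ω).toNat)

/-- `B` is a Bernoulli factory for `f` on `S`: for every parameter `p ∈ S` of the input, `N` is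
almost surely finite and the output `Y` is a Bernoulli variable with parameter `f p`. The
algorithm itself does not depend on `p`. -/
def IsFactory (B : Algorithm) (S : Set ℝ) (f : ℝ → ℝ) : Prop :=
  ∀ p : I, (p : ℝ) ∈ S →
    (∀ᵐ ω ∂inputLaw p, B.stopTime ω < ⊤) ∧
    (inputLaw p).real {ω | B.output ω = true} = f p

/-- `B` is fast on `S`: for each `p ∈ S` the distribution of `N` has an exponential tail, with
constants that may depend on `p`. -/
def IsFast (B : Algorithm) (S : Set ℝ) : Prop :=
  ∀ p : I, (p : ℝ) ∈ S → ∃ A β : ℝ, 0 < A ∧ β < 1 ∧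
    ∀ n : ℕ, (inputLaw p).real {ω | (n : ℕ∞) < B.stopTime ω} ≤ A * β ^ n

/-- The mean number of inputs `E[N]` when the parameter of the input is `p`. -/
noncomputable def meanInputs (B : Algorithm) (p : I) : ℝ≥0∞ :=
  ∫⁻ ω, (B.stopTime ω : ℝ≥0∞) ∂inputLaw p

end Algorithm

end BernoulliFactory

/-! ### Input laws, the filtration of the past, and independence of the next input. -/

namespace BernoulliFactory

/-! This is a Cramér–Rao argument carried out with finite increments. Compare p with some q > p and
truncate the experiment at horizon m. The likelihood ratio of the stopped experiment, minus 1, is a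
sum of orthogonal martingale differences. Each input consumed contributes the χ² divergence (q -
p)²/(p(1 - p)) times a squared likelihood, which is at most (q/p)^(2m). So the second moment is at
most (q - p)²/(p(1 - p)) · (q/p)^(2m) · E[N] (`integral_score_sq_le`, `sum_real_running_le`). The
covariance of this score with the event "stopped by time m with output 1" is the change of that
event's probability from p to q (`real_sub_real_eq_integral_score`), and Cauchy–Schwarz gives
`sq_real_sub_real_le`.

To reach the derivative, `abs_deriv_le` couples the increment to the horizon by q = p + m⁻². Then
(q/p)^m → 1, while the truncation error, at most (1 + (q/p)^m) A β^m, vanishes even after division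
by m⁻². Nothing is differentiated under an expectation. The tail constants need no uniformity in the
parameter, because `real_running_le` carries the tail at p over to q. -/

instance (p : I) : IsProbabilityMeasure (inputLaw p) := by
  unfold inputLaw; infer_instance

/-- The law of one input pair. -/
noncomputable def pairLaw (p : I) : Measure (Bool × ℝ) :=
  (bernoulliMeasure true false p).prod uniform01

instance (p : I) : IsProbabilityMeasure (pairLaw p) := by
  unfold pairLaw; infer_instance

lemma inputLaw_eq (p : I) : inputLaw p = Measure.infinitePi fun _ : ℕ => pairLaw p := rfl

/-- The events determined by the first `k` input pairs. -/
@[reducible] def past (k : ℕ) : MeasurableSpace (ℕ → Bool × ℝ) :=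
  MeasurableSpace.comap (fun ω => initial ω k) inferInstance

lemma measurable_initial (k : ℕ) : Measurable fun ω => initial ω k := by
  unfold initial; fun_prop

lemma past_le (k : ℕ) : past k ≤ MeasurableSpace.pi := (measurable_initial k).comap_le

lemma measurable_past_initial {j k : ℕ} (h : j ≤ k) :
    Measurable[past k] fun ω => initial ω j := by
  have h1 : Measurable[past k] fun ω => initial ω k := comap_measurable _
  have h2 : Measurable fun x : Fin k → Bool × ℝ => fun i : Fin j => x (Fin.castLE h i) := by
    fun_prop
  exact h2.comp h1

lemma past_mono {j k : ℕ} (h : j ≤ k) : past j ≤ past k :=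
  (measurable_past_initial h).comap_le

lemma measurable_past_apply {i k : ℕ} (h : i < k) :
    Measurable[past k] fun ω : ℕ → Bool × ℝ => ω i := by
  have h1 : Measurable[past k] fun ω => initial ω k := comap_measurable _
  exact (measurable_pi_apply (⟨i, h⟩ : Fin k)).comp h1

lemma map_apply_inputLaw (p : I) (k : ℕ) : (inputLaw p).map (fun ω => ω k) = pairLaw p :=
  Measure.infinitePi_map_eval (μ := fun _ : ℕ => pairLaw p) k

/-- Disjoint blocks of coordinates, here those below k and k itself, generate independent σ-algebras
under a product measure. -/
lemma indep_past_apply (p : I) (k : ℕ) :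
    Indep (past k) (MeasurableSpace.comap (fun ω : ℕ → Bool × ℝ => ω k) inferInstance)
      (inputLaw p) := by
  have h : iIndepFun (fun (i : ℕ) (ω : ℕ → Bool × ℝ) => ω i) (inputLaw p) :=
    iIndepFun_infinitePi (P := fun _ : ℕ => pairLaw p) (X := fun _ x => x) (fun _ => by fun_prop)
  have h2 := indep_iSup_of_disjoint (fun i => (measurable_pi_apply i).comap_le) h
    (S := Set.Iio k) (T := {k}) (by simp)
  refine indep_of_indep_of_le_left (indep_of_indep_of_le_right h2 ?_) ?_
  · simp
  · unfold past MeasurableSpace.pi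
    rw [MeasurableSpace.comap_iSup]
    refine iSup_le fun i => ?_
    rw [MeasurableSpace.comap_comp]
    exact le_iSup₂_of_le (i : ℕ) i.2 le_rfl

/-- A function of the present input pair is independent of the past. -/
lemma integral_past_mul (p : I) (k : ℕ) {G : (ℕ → Bool × ℝ) → ℝ} (hG : Measurable[past k] G)
    {φ : Bool × ℝ → ℝ} (hφ : Measurable φ) :
    ∫ ω, G ω * φ (ω k) ∂inputLaw p = (∫ ω, G ω ∂inputLaw p) * ∫ x, φ x ∂pairLaw p := by
  have h : IndepFun G (fun ω : ℕ → Bool × ℝ => φ (ω k)) (inputLaw p) := by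
    refine indep_of_indep_of_le_left (indep_of_indep_of_le_right (indep_past_apply p k) ?_) ?_
    · exact (hφ.comp (comap_measurable _)).comap_le
    · exact hG.comap_le
  have hG' : Measurable G := hG.mono (past_le k) le_rfl
  have hφ' : Measurable fun ω : ℕ → Bool × ℝ => φ (ω k) := hφ.comp (measurable_pi_apply k)
  rw [h.integral_fun_mul_eq_mul_integral hG'.aestronglyMeasurable hφ'.aestronglyMeasurable,
    ← map_apply_inputLaw p k, integral_map (measurable_pi_apply k).aemeasurable
      hφ.aestronglyMeasurable]

lemma integral_pairLaw (p : I) (φ : Bool → ℝ) :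
    ∫ x, φ x.1 ∂pairLaw p = p * φ true + (1 - p) * φ false := by
  have h : (pairLaw p).map Prod.fst = bernoulliMeasure true false p := by
    simp [pairLaw, Measure.map_fst_prod]
  rw [← integral_map (f := φ) measurable_fst.aemeasurable
    (measurable_of_finite _).aestronglyMeasurable, h]
  simp [integral_bernoulliMeasure]

/-! ### Likelihood ratios and change of measure. -/

/-- The likelihood ratio of one input bit, for the parameters `q` and `p`. -/
noncomputable def ratio (p q : I) (x : Bool × ℝ) : ℝ :=
  bif x.1 then (q : ℝ) / p else (1 - q) / (1 - p)

lemma measurable_ratio (p q : I) : Measurable (ratio p q) :=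
  (measurable_of_finite fun b : Bool => bif b then (q : ℝ) / p else (1 - q) / (1 - p)).comp
    measurable_fst

lemma ratio_nonneg (p q : I) (x : Bool × ℝ) : 0 ≤ ratio p q x := by
  have := p.2.1; have := p.2.2; have := q.2.1; have := q.2.2
  unfold ratio
  cases x.1
  · exact div_nonneg (by linarith) (by linarith)
  · exact div_nonneg (by linarith) (by linarith)

/-- Only the bit depends on the parameter; the uniform factor is common to both laws and drops out
of the density. Since p is interior, neither denominator vanishes. -/
lemma pairLaw_withDensity (p q : I) (hp : (p : ℝ) ∈ Set.Ioo (0 : ℝ) 1) :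
    (pairLaw p).withDensity (fun x => ENNReal.ofReal (ratio p q x)) = pairLaw q := by
  have hm : Measurable fun b : Bool =>
    ENNReal.ofReal (bif b then (q : ℝ) / p else (1 - q) / (1 - p)) := measurable_of_finite _
  have h : (bernoulliMeasure true false p).withDensity (fun b =>
    ENNReal.ofReal (bif b then (q : ℝ) / p else (1 - q) / (1 - p))) =
      bernoulliMeasure true false q := by
    have hp1 : (p : ℝ) ≠ 0 := hp.1.ne'
    have hp2 : 1 - (p : ℝ) ≠ 0 := (sub_pos.2 hp.2).ne'
    have hq : (0 : ℝ) ≤ 1 - q := sub_nonneg.2 q.2.2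
    refine Measure.ext_of_singleton fun b => ?_
    rw [withDensity_apply _ (measurableSet_singleton b), lintegral_singleton,
      ← ENNReal.toReal_eq_toReal_iff' (by finiteness) (by finiteness), ENNReal.toReal_mul]
    cases b
    · simp [ENNReal.toReal_ofReal (div_nonneg hq (sub_pos.2 hp.2).le), hp2]
    · simp [ENNReal.toReal_ofReal (div_nonneg q.2.1 hp.1.le), hp1]
  unfold pairLaw
  rw [← h, prod_withDensity_left hm]
  rfl

/-- The likelihood ratio of the first `m` inputs. -/
noncomputable def likelihood (p q : I) (m : ℕ) (ω : ℕ → Bool × ℝ) : ℝ :=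
  ∏ i ∈ Finset.range m, ratio p q (ω i)

lemma likelihood_succ (p q : I) (m : ℕ) (ω : ℕ → Bool × ℝ) :
    likelihood p q (m + 1) ω = likelihood p q m ω * ratio p q (ω m) :=
  Finset.prod_range_succ _ _

lemma likelihood_nonneg (p q : I) (m : ℕ) (ω : ℕ → Bool × ℝ) : 0 ≤ likelihood p q m ω :=
  Finset.prod_nonneg fun _ _ => ratio_nonneg _ _ _

lemma measurable_likelihood (p q : I) (m : ℕ) : Measurable[past m] (likelihood p q m) := by
  let _ := past m
  refine Finset.measurable_fun_prod _ fun i hi => ?_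
  exact (measurable_ratio p q).comp (measurable_past_apply (Finset.mem_range.1 hi))

lemma preimage_initial_pi {m : ℕ} (s : Fin m → Set (Bool × ℝ)) :
    (fun ω => initial ω m) ⁻¹' Set.univ.pi s =
      (Finset.range m : Set ℕ).pi fun i => if h : i < m then s ⟨i, h⟩ else Set.univ := by
  ext ω
  simp only [Set.mem_preimage, Set.mem_pi, Set.mem_univ, forall_const, initial,
    Finset.coe_range, Set.mem_Iio]
  refine ⟨fun h i hi => by simpa [hi] using h ⟨i, hi⟩, fun h i => by simpa using h i i.2⟩

lemma map_initial_inputLaw (p : I) (m : ℕ) :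
    (inputLaw p).map (fun ω => initial ω m) = Measure.pi fun _ : Fin m => pairLaw p := by
  refine (Measure.pi_eq fun s hs => ?_).symm
  rw [Measure.map_apply (measurable_initial m) (MeasurableSet.univ_pi hs), preimage_initial_pi,
    inputLaw_eq, Measure.infinitePi_pi _ (by intro i hi; split_ifs <;> simp [hs]),
    ← Fin.prod_univ_eq_prod_range]
  simp

/-- It suffices to test boxes. On a box the density times the indicator is a product of one function
per coordinate, so independence factors the integral and each factor is the one-step change of
measure. -/
lemma map_initial_withDensity (p q : I) (hp : (p : ℝ) ∈ Set.Ioo (0 : ℝ) 1) (m : ℕ) :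
    ((inputLaw p).withDensity fun ω => ENNReal.ofReal (likelihood p q m ω)).map
      (fun ω => initial ω m) = Measure.pi fun _ : Fin m => pairLaw q := by
  refine (Measure.pi_eq fun s hs => ?_).symm
  set t : ℕ → Set (Bool × ℝ) := fun i => if h : i < m then s ⟨i, h⟩ else Set.univ with ht
  have htm : ∀ i, MeasurableSet (t i) := by
    intro i; simp only [ht]; split_ifs <;> simp [hs]
  have hS : MeasurableSet ((fun ω => initial ω m) ⁻¹' Set.univ.pi s) :=
    measurable_initial m (MeasurableSet.univ_pi hs)
  have hr : Measurable fun x => ENNReal.ofReal (ratio p q x) := (measurable_ratio p q).ennreal_ofReal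
  have hg : ∀ i, Measurable ((t i).indicator fun x => ENNReal.ofReal (ratio p q x)) :=
    fun i => hr.indicator (htm i)
  have hind : iIndepFun (fun (i : ℕ) (ω : ℕ → Bool × ℝ) =>
      (t i).indicator (fun x => ENNReal.ofReal (ratio p q x)) (ω i)) (inputLaw p) :=
    iIndepFun_infinitePi (P := fun _ : ℕ => pairLaw p) hg
  rw [Measure.map_apply (measurable_initial m) (MeasurableSet.univ_pi hs),
    withDensity_apply _ hS, ← lintegral_indicator hS]
  have hprod : ∀ ω, ((fun ω => initial ω m) ⁻¹' Set.univ.pi s).indicator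
      (fun ω => ENNReal.ofReal (likelihood p q m ω)) ω =
      ∏ i ∈ Finset.range m, (t i).indicator (fun x => ENNReal.ofReal (ratio p q x)) (ω i) := by
    intro ω
    rw [preimage_initial_pi]
    by_cases hω : ω ∈ (Finset.range m : Set ℕ).pi t
    · rw [Set.indicator_of_mem hω, likelihood,
        ENNReal.ofReal_prod_of_nonneg fun _ _ => ratio_nonneg _ _ _]
      exact Finset.prod_congr rfl fun i hi => (Set.indicator_of_mem (hω i hi)
          fun x => ENNReal.ofReal (ratio p q x)).symm
    · rw [Set.indicator_of_notMem hω]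
      simp only [Set.mem_pi, not_forall] at hω
      obtain ⟨i, hi, hω⟩ := hω
      exact (Finset.prod_eq_zero hi (Set.indicator_of_notMem hω _)).symm
  rw [lintegral_congr hprod, lintegral_prod_eq_prod_lintegral_of_indepFun _ _ hind
    fun i => (hg i).comp (measurable_pi_apply i), ← Fin.prod_univ_eq_prod_range
    (fun i => ∫⁻ ω, (t i).indicator (fun x => ENNReal.ofReal (ratio p q x)) (ω i) ∂inputLaw p)]
  refine Finset.prod_congr rfl fun i _ => ?_
  rw [← lintegral_map (hg i) (measurable_pi_apply _), map_apply_inputLaw,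
    lintegral_indicator (htm i), ← withDensity_apply _ (htm i), pairLaw_withDensity p q hp]
  simp [ht]

/-- Change of measure on the events determined by the first `m` inputs. -/
lemma inputLaw_eq_setLIntegral (p q : I) (hp : (p : ℝ) ∈ Set.Ioo (0 : ℝ) 1) (m : ℕ)
    {A : Set (ℕ → Bool × ℝ)} (hA : MeasurableSet[past m] A) :
    inputLaw q A = ∫⁻ ω in A, ENNReal.ofReal (likelihood p q m ω) ∂inputLaw p := by
  obtain ⟨A', hA', rfl⟩ := hA
  rw [← withDensity_apply _ (measurable_initial m hA'),
    ← Measure.map_apply (measurable_initial m) hA', ← Measure.map_apply (measurable_initial m) hA',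
    map_initial_withDensity p q hp, map_initial_inputLaw]

lemma inputLaw_real_eq_integral (p q : I) (hp : (p : ℝ) ∈ Set.Ioo (0 : ℝ) 1) (m : ℕ)
    {A : Set (ℕ → Bool × ℝ)} (hA : MeasurableSet[past m] A) :
    (inputLaw q).real A = ∫ ω in A, likelihood p q m ω ∂inputLaw p := by
  rw [integral_eq_lintegral_of_nonneg_ae (ae_of_all _ fun ω => likelihood_nonneg p q m ω)
    ((measurable_likelihood p q m).mono (past_le m) le_rfl).aestronglyMeasurable,
    ← inputLaw_eq_setLIntegral p q hp m hA, Measure.real]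

end BernoulliFactory

/-! ### Bounded adapted functions, the score martingale and its second moment. -/

namespace BernoulliFactory

/-- Bounded functions that are measurable for the past before time `k`. -/
structure IsBoundedAt (k : ℕ) (g : (ℕ → Bool × ℝ) → ℝ) : Prop where
  measurable : Measurable[past k] g
  bounded : ∃ C : ℝ, ∀ ω, |g ω| ≤ C

namespace IsBoundedAt

variable {k l : ℕ} {g g' : (ℕ → Bool × ℝ) → ℝ}

lemma mono (hg : IsBoundedAt k g) (h : k ≤ l) : IsBoundedAt l g :=
  ⟨hg.1.mono (past_mono h) le_rfl, hg.2⟩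

lemma mul (hg : IsBoundedAt k g) (hg' : IsBoundedAt k g') : IsBoundedAt k fun ω => g ω * g' ω := by
  obtain ⟨C, hC⟩ := hg.2
  obtain ⟨C', hC'⟩ := hg'.2
  refine ⟨hg.1.mul hg'.1, C * C', fun ω => ?_⟩
  rw [abs_mul]
  exact mul_le_mul (hC ω) (hC' ω) (abs_nonneg _) ((abs_nonneg _).trans (hC ω))

lemma add (hg : IsBoundedAt k g) (hg' : IsBoundedAt k g') : IsBoundedAt k fun ω => g ω + g' ω := by
  obtain ⟨C, hC⟩ := hg.2
  obtain ⟨C', hC'⟩ := hg'.2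
  exact ⟨hg.1.add hg'.1, C + C', fun ω => (abs_add_le _ _).trans (add_le_add (hC ω) (hC' ω))⟩

lemma const (c : ℝ) : IsBoundedAt k fun _ => c :=
  ⟨measurable_const, |c|, fun _ => le_rfl⟩

lemma sub (hg : IsBoundedAt k g) (hg' : IsBoundedAt k g') : IsBoundedAt k fun ω => g ω - g' ω := by
  have h := hg.add ((const (k := k) (-1)).mul hg')
  simpa only [neg_mul, one_mul, ← sub_eq_add_neg] using h

lemma indicator {A : Set (ℕ → Bool × ℝ)} (hA : MeasurableSet[past k] A) :
    IsBoundedAt k (A.indicator 1) := by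
  refine ⟨(measurable_const (a := (1 : ℝ))).indicator hA, 1, fun ω => ?_⟩
  by_cases h : ω ∈ A <;> simp [h]

lemma integrable (hg : IsBoundedAt k g) (p : I) : Integrable g (inputLaw p) := by
  obtain ⟨C, hC⟩ := hg.2
  exact Integrable.of_bound (hg.1.mono (past_le k) le_rfl).aestronglyMeasurable C
    (ae_of_all _ hC)

end IsBoundedAt

/-- The Cauchy–Schwarz inequality for bounded functions. -/
lemma sq_integral_mul_le {k : ℕ} {g g' : (ℕ → Bool × ℝ) → ℝ} (hg : IsBoundedAt k g)
    (hg' : IsBoundedAt k g') (p : I) :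
    (∫ ω, g ω * g' ω ∂inputLaw p) ^ 2 ≤
      (∫ ω, g ω ^ 2 ∂inputLaw p) * ∫ ω, g' ω ^ 2 ∂inputLaw p := by
  have h1 : Integrable (fun ω => g ω ^ 2) (inputLaw p) := by
    simpa only [sq] using (hg.mul hg).integrable p
  have h2 : Integrable (fun ω => g' ω ^ 2) (inputLaw p) := by
    simpa only [sq] using (hg'.mul hg').integrable p
  have h3 := (hg.mul hg').integrable p
  have h : ∀ t : ℝ, 0 ≤ (∫ ω, g ω ^ 2 ∂inputLaw p) * (t * t) +
      (2 * ∫ ω, g ω * g' ω ∂inputLaw p) * t + ∫ ω, g' ω ^ 2 ∂inputLaw p := by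
    intro t
    have h0 : 0 ≤ ∫ ω, (g ω ^ 2 * (t * t) + 2 * (g ω * g' ω) * t + g' ω ^ 2) ∂inputLaw p :=
      integral_nonneg fun ω => by
        have : g ω ^ 2 * (t * t) + 2 * (g ω * g' ω) * t + g' ω ^ 2 = (g ω * t + g' ω) ^ 2 := by ring
        simp only [this]; positivity
    rwa [integral_add ((h1.mul_const _).fun_add ((h3.const_mul 2).mul_const t)) h2,
      integral_add (h1.mul_const _) ((h3.const_mul 2).mul_const t), integral_mul_const,
      integral_mul_const, integral_const_mul] at h0
  have := discrim_le_zero h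
  rw [discrim] at this
  nlinarith

lemma isBoundedAt_ratio (p q : I) (k : ℕ) :
    IsBoundedAt (k + 1) fun ω => ratio p q (ω k) := by
  refine ⟨(measurable_ratio p q).comp (measurable_past_apply k.lt_succ_self),
    max |(q : ℝ) / p| |(1 - q) / (1 - p : ℝ)|, fun ω => ?_⟩
  unfold ratio
  cases (ω k).1 <;> simp

lemma isBoundedAt_likelihood (p q : I) (k : ℕ) : IsBoundedAt k (likelihood p q k) := by
  induction k with
  | zero => exact IsBoundedAt.const 1
  | succ k ih =>
    rw [funext (likelihood_succ p q k)]
    exact (ih.mono k.le_succ).mul (isBoundedAt_ratio p q k)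

lemma integral_ratio_sub_one (p q : I) (hp : (p : ℝ) ∈ Set.Ioo (0 : ℝ) 1) :
    ∫ x, (ratio p q x - 1) ∂pairLaw p = 0 := by
  have hp1 : (p : ℝ) ≠ 0 := hp.1.ne'
  have hp2 : 1 - (p : ℝ) ≠ 0 := (sub_pos.2 hp.2).ne'
  refine (integral_pairLaw p fun b => (bif b then (q : ℝ) / p else (1 - q) / (1 - p)) - 1).trans ?_
  simp only [cond_true, cond_false]
  field_simp
  ring

/-- This is the χ² divergence between the two Bernoulli laws, and the source of the factor p(1 - p)
in the final bound. -/
lemma integral_ratio_sub_one_sq (p q : I) (hp : (p : ℝ) ∈ Set.Ioo (0 : ℝ) 1) :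
    ∫ x, (ratio p q x - 1) ^ 2 ∂pairLaw p = ((q : ℝ) - p) ^ 2 / (p * (1 - p)) := by
  have hp1 : (p : ℝ) ≠ 0 := hp.1.ne'
  have hp2 : 1 - (p : ℝ) ≠ 0 := (sub_pos.2 hp.2).ne'
  refine (integral_pairLaw p
    fun b => ((bif b then (q : ℝ) / p else (1 - q) / (1 - p)) - 1) ^ 2).trans ?_
  simp only [cond_true, cond_false]
  field_simp
  ring

/-- The martingale difference property: the centred ratio has mean zero and is independent of the
past. -/
lemma integral_past_mul_ratio_sub_one (p q : I) (hp : (p : ℝ) ∈ Set.Ioo (0 : ℝ) 1) {k : ℕ}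
    {g : (ℕ → Bool × ℝ) → ℝ} (hg : Measurable[past k] g) :
    ∫ ω, g ω * (ratio p q (ω k) - 1) ∂inputLaw p = 0 := by
  rw [integral_past_mul p k hg ((measurable_ratio p q).sub_const 1),
    integral_ratio_sub_one p q hp, mul_zero]

/-- For q ≥ p the larger one-step ratio is q/p, and it is at least 1. This is why the parameter is
only ever moved to the right. -/
lemma likelihood_le (p q : I) (hp : (p : ℝ) ∈ Set.Ioo (0 : ℝ) 1) (hpq : p ≤ q) {k m : ℕ}
    (hk : k ≤ m) (ω : ℕ → Bool × ℝ) : likelihood p q k ω ≤ ((q : ℝ) / p) ^ m := by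
  have hpq' : (p : ℝ) ≤ q := hpq
  have h1 : 1 ≤ (q : ℝ) / p := (one_le_div hp.1).2 hpq'
  have h2 : (1 - q : ℝ) / (1 - p) ≤ 1 := (div_le_one (sub_pos.2 hp.2)).2 (by linarith)
  have h : ∀ x, ratio p q x ≤ (q : ℝ) / p := by
    rintro ⟨b, u⟩
    cases b
    · exact h2.trans h1
    · exact le_rfl
  calc likelihood p q k ω ≤ ∏ _i ∈ Finset.range k, (q : ℝ) / p :=
        Finset.prod_le_prod (fun _ _ => ratio_nonneg _ _ _) fun _ _ => h _
    _ = ((q : ℝ) / p) ^ k := by rw [Finset.prod_const, Finset.card_range]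
    _ ≤ ((q : ℝ) / p) ^ m := pow_le_pow_right₀ h1 hk

/-- The score of a stopped experiment: the martingale `L_{N ∧ m} - 1`, where the event `A k`
says that the experiment is still running after `k` inputs. -/
noncomputable def score (p q : I) (A : ℕ → Set (ℕ → Bool × ℝ)) (m : ℕ) (ω : ℕ → Bool × ℝ) : ℝ :=
  ∑ k ∈ Finset.range m, (A k).indicator 1 ω * likelihood p q k ω * (ratio p q (ω k) - 1)

lemma score_succ (p q : I) (A : ℕ → Set (ℕ → Bool × ℝ)) (m : ℕ) (ω : ℕ → Bool × ℝ) :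
    score p q A (m + 1) ω = score p q A m ω +
      (A m).indicator 1 ω * likelihood p q m ω * (ratio p q (ω m) - 1) :=
  Finset.sum_range_succ _ _

section Score

variable {p q : I} {A : ℕ → Set (ℕ → Bool × ℝ)}

lemma isBoundedAt_score_weight (hA : ∀ k, MeasurableSet[past k] (A k)) (k : ℕ) :
    IsBoundedAt k fun ω => (A k).indicator 1 ω * likelihood p q k ω :=
  (IsBoundedAt.indicator (hA k)).mul (isBoundedAt_likelihood p q k)

lemma isBoundedAt_score_term (hA : ∀ k, MeasurableSet[past k] (A k)) (k : ℕ) :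
    IsBoundedAt (k + 1) fun ω =>
      (A k).indicator 1 ω * likelihood p q k ω * (ratio p q (ω k) - 1) :=
  ((isBoundedAt_score_weight hA k).mono k.le_succ).mul
    ((isBoundedAt_ratio p q k).sub (IsBoundedAt.const 1))

lemma isBoundedAt_score (hA : ∀ k, MeasurableSet[past k] (A k)) (m : ℕ) :
    IsBoundedAt m (score p q A m) := by
  induction m with
  | zero => exact IsBoundedAt.const 0
  | succ m ih =>
    rw [funext (score_succ p q A m)]
    exact (ih.mono m.le_succ).add (isBoundedAt_score_term hA m)

lemma integral_score (hp : (p : ℝ) ∈ Set.Ioo (0 : ℝ) 1)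
    (hA : ∀ k, MeasurableSet[past k] (A k)) (m : ℕ) :
    ∫ ω, score p q A m ω ∂inputLaw p = 0 := by
  induction m with
  | zero => simp [score]
  | succ m ih =>
    simp only [score_succ]
    rw [integral_add ((isBoundedAt_score hA m).integrable p)
      ((isBoundedAt_score_term hA m).integrable p), ih,
      integral_past_mul_ratio_sub_one p q hp (isBoundedAt_score_weight hA m).1, add_zero]

/-- The second moment of the score is controlled by the expected running time. -/
lemma integral_score_sq_le (hp : (p : ℝ) ∈ Set.Ioo (0 : ℝ) 1) (hpq : p ≤ q)
    (hA : ∀ k, MeasurableSet[past k] (A k)) {m n : ℕ} (hmn : m ≤ n) :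
    ∫ ω, score p q A m ω ^ 2 ∂inputLaw p ≤
      ((q : ℝ) - p) ^ 2 / (p * (1 - p)) * (((q : ℝ) / p) ^ n) ^ 2 *
        ∑ k ∈ Finset.range m, (inputLaw p).real (A k) := by
  induction m with
  | zero => simp [score]
  | succ m ih =>
    have hs := isBoundedAt_score (p := p) (q := q) hA m
    have hw := isBoundedAt_score_weight (p := p) (q := q) hA m
    have ht := isBoundedAt_score_term (p := p) (q := q) hA m
    set w : (ℕ → Bool × ℝ) → ℝ := fun ω => (A m).indicator 1 ω * likelihood p q m ω with hwdef
    -- The cross term has a weight known at time m, so it integrates to zero; the last term factors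
    -- into the mean of `w ω * w ω` and the χ² divergence.
    have hexp : ∀ ω, score p q A (m + 1) ω ^ 2 = score p q A m ω ^ 2 +
        2 * score p q A m ω * w ω * (ratio p q (ω m) - 1) +
        w ω * w ω * (ratio p q (ω m) - 1) ^ 2 := by
      intro ω; rw [score_succ]; ring
    have hr : IsBoundedAt (m + 1) fun ω => ratio p q (ω m) - 1 :=
      (isBoundedAt_ratio p q m).sub (IsBoundedAt.const 1)
    have i1 : Integrable (fun ω => score p q A m ω ^ 2) (inputLaw p) := by
      simpa only [sq] using (hs.mul hs).integrable p
    have b2 : IsBoundedAt m fun ω => 2 * score p q A m ω * w ω :=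
      ((IsBoundedAt.const 2).mul hs).mul hw
    have i2 := ((b2.mono m.le_succ).mul hr).integrable p
    have i3 : Integrable (fun ω => w ω * w ω * (ratio p q (ω m) - 1) ^ 2) (inputLaw p) := by
      simpa only [sq] using (((hw.mul hw).mono m.le_succ).mul (hr.mul hr)).integrable p
    have hAm : MeasurableSet (A m) := past_le m _ (hA m)
    have hwle : ∫ ω, w ω * w ω ∂inputLaw p ≤ (((q : ℝ) / p) ^ n) ^ 2 * (inputLaw p).real (A m) := by
      rw [← integral_indicator_one hAm, ← integral_const_mul]
      refine integral_mono ((hw.mul hw).integrable p)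
        (((IsBoundedAt.indicator (hA m)).integrable p).const_mul _) fun ω => ?_
      have h0 := likelihood_nonneg p q m ω
      have h1 := likelihood_le p q hp hpq (m.le_succ.trans hmn) ω
      by_cases h : ω ∈ A m
      · simp only [hwdef, Set.indicator_of_mem h, Pi.one_apply, one_mul, mul_one]
        nlinarith
      · simp [hwdef, Set.indicator_of_notMem h]
    have hχ : 0 ≤ ((q : ℝ) - p) ^ 2 / (p * (1 - p)) :=
      div_nonneg (sq_nonneg _) (mul_nonneg hp.1.le (sub_pos.2 hp.2).le)
    rw [integral_congr_ae (ae_of_all _ hexp), integral_add (i1.fun_add i2) i3, integral_add i1 i2,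
      integral_past_mul_ratio_sub_one p q hp b2.1, add_zero,
      integral_past_mul p m (hw.mul hw).1 (((measurable_ratio p q).sub_const 1).pow_const 2),
      integral_ratio_sub_one_sq p q hp, Finset.sum_range_succ, mul_add]
    refine add_le_add (ih (m.le_succ.trans hmn)) ?_
    nlinarith [mul_le_mul_of_nonneg_left hwle hχ]

/-- Changing the parameter shifts the probability of an event that is decided once the experiment
stops by its correlation with the score. -/
lemma real_sub_real_eq_integral_score (hp : (p : ℝ) ∈ Set.Ioo (0 : ℝ) 1)
    (hA : ∀ k, MeasurableSet[past k] (A k)) {E : Set (ℕ → Bool × ℝ)} {m : ℕ}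
    (hE : MeasurableSet[past m] E) (hEA : ∀ k < m, MeasurableSet[past k] (E \ A k)) :
    (inputLaw q).real E - (inputLaw p).real E =
      ∫ ω, score p q A m ω * E.indicator 1 ω ∂inputLaw p := by
  have hE' : MeasurableSet E := past_le m _ hE
  -- At j = m the left side is the probability under q. The induction trades the full likelihood for
  -- the stopped one.
  have key : ∀ j ≤ m, ∫ ω, likelihood p q j ω * E.indicator 1 ω ∂inputLaw p =
      (inputLaw p).real E + ∫ ω, score p q A j ω * E.indicator 1 ω ∂inputLaw p := by
    intro j
    induction j with
    | zero =>
      intro _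
      simp [likelihood, score, integral_indicator_one hE']
    | succ j ih =>
      intro hj
      have hL := (isBoundedAt_likelihood p q j).mono (Nat.le_of_succ_le hj)
      have hs := (isBoundedAt_score (p := p) (q := q) hA j).mono (Nat.le_of_succ_le hj)
      have ht := (isBoundedAt_score_term (p := p) (q := q) hA j).mono hj
      have hI := IsBoundedAt.indicator hE
      have hr := ((isBoundedAt_ratio p q j).sub (IsBoundedAt.const 1)).mono hj
      -- On the stopped part the event is already decided at time j, so the likelihood increment
      -- there averages to zero and the score may omit it.
      have hd : IsBoundedAt j fun ω => likelihood p q j ω * (E \ A j).indicator 1 ω :=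
        (isBoundedAt_likelihood p q j).mul (IsBoundedAt.indicator (hEA j hj))
      have e1 : ∀ ω, likelihood p q (j + 1) ω * E.indicator 1 ω =
          likelihood p q j ω * E.indicator 1 ω +
          ((A j).indicator 1 ω * likelihood p q j ω * (ratio p q (ω j) - 1) * E.indicator 1 ω +
            likelihood p q j ω * (E \ A j).indicator 1 ω * (ratio p q (ω j) - 1)) := by
        intro ω
        rw [likelihood_succ]
        by_cases h1 : ω ∈ E <;> by_cases h2 : ω ∈ A j <;> simp [h1, h2] <;> ring
      have e2 : ∀ ω, score p q A (j + 1) ω * E.indicator 1 ω = score p q A j ω * E.indicator 1 ω +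
          (A j).indicator 1 ω * likelihood p q j ω * (ratio p q (ω j) - 1) * E.indicator 1 ω := by
        intro ω; rw [score_succ, add_mul]
      rw [integral_congr_ae (ae_of_all _ e1), integral_congr_ae (ae_of_all _ e2),
        integral_add ((hL.mul hI).integrable p) (((ht.mul hI).integrable p).fun_add
          (((hd.mono (Nat.le_of_succ_le hj)).mul hr).integrable p)),
        integral_add ((ht.mul hI).integrable p)
          (((hd.mono (Nat.le_of_succ_le hj)).mul hr).integrable p),
        integral_add ((hs.mul hI).integrable p) ((ht.mul hI).integrable p),
        integral_past_mul_ratio_sub_one p q hp hd.1, ih (Nat.le_of_succ_le hj)]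
      ring
  have hm := key m le_rfl
  have hq : (inputLaw q).real E = ∫ ω, likelihood p q m ω * E.indicator 1 ω ∂inputLaw p := by
    rw [inputLaw_real_eq_integral p q hp m hE, ← integral_indicator hE']
    refine integral_congr_ae (ae_of_all _ fun ω => ?_)
    by_cases h : ω ∈ E <;> simp [h]
  rw [hq, hm, add_sub_cancel_left]

lemma integral_indicator_sub_real_sq (p : I) {E : Set (ℕ → Bool × ℝ)} (hE : MeasurableSet E) :
    ∫ ω, (E.indicator 1 ω - (inputLaw p).real E) ^ 2 ∂inputLaw p =
      (inputLaw p).real E * (1 - (inputLaw p).real E) := by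
  set e := (inputLaw p).real E
  have h : ∀ ω, (E.indicator (1 : (ℕ → Bool × ℝ) → ℝ) ω - e) ^ 2 =
      (1 - 2 * e) * E.indicator (1 : (ℕ → Bool × ℝ) → ℝ) ω + e ^ 2 := by
    intro ω
    by_cases h : ω ∈ E
    · simp [h]; ring
    · simp [h]
  have hi : Integrable (E.indicator (1 : (ℕ → Bool × ℝ) → ℝ)) (inputLaw p) :=
    (integrable_const (1 : ℝ)).indicator hE
  rw [integral_congr_ae (ae_of_all _ h), integral_add (hi.const_mul _) (integrable_const _),
    integral_const_mul, integral_indicator_one hE]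
  simp
  ring

/-- A Hammersley–Chapman–Robbins bound for a sequential experiment. -/
theorem sq_real_sub_real_le (hp : (p : ℝ) ∈ Set.Ioo (0 : ℝ) 1) (hpq : p ≤ q)
    (hA : ∀ k, MeasurableSet[past k] (A k)) {E : Set (ℕ → Bool × ℝ)} {m : ℕ}
    (hE : MeasurableSet[past m] E) (hEA : ∀ k < m, MeasurableSet[past k] (E \ A k)) :
    ((inputLaw q).real E - (inputLaw p).real E) ^ 2 ≤
      ((q : ℝ) - p) ^ 2 / (p * (1 - p)) * (((q : ℝ) / p) ^ m) ^ 2 *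
        (∑ k ∈ Finset.range m, (inputLaw p).real (A k)) *
        ((inputLaw p).real E * (1 - (inputLaw p).real E)) := by
  have hs := isBoundedAt_score (p := p) (q := q) hA m
  have hI := IsBoundedAt.indicator hE
  have hE' : MeasurableSet E := past_le m _ hE
  set e := (inputLaw p).real E with he
  -- Because the score has mean zero, the indicator may be centred; this replaces its second moment
  -- by its variance.
  have h1 : (inputLaw q).real E - e =
      ∫ ω, score p q A m ω * (E.indicator 1 ω - e) ∂inputLaw p := by
    simp only [mul_sub]
    rw [integral_sub ((hs.mul hI).integrable p) ((hs.integrable p).mul_const e),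
      integral_mul_const, integral_score hp hA, zero_mul, sub_zero,
      real_sub_real_eq_integral_score hp hA hE hEA]
  rw [h1]
  refine (sq_integral_mul_le hs (hI.sub (IsBoundedAt.const e)) p).trans ?_
  rw [integral_indicator_sub_real_sq p hE']
  refine mul_le_mul_of_nonneg_right (integral_score_sq_le hp hpq hA le_rfl) ?_
  exact mul_nonneg measureReal_nonneg (sub_nonneg.2 measureReal_le_one)

end Score

end BernoulliFactory

/-! ### Stopping events of an algorithm and truncation errors. -/

namespace BernoulliFactory

namespace Algorithm

variable (B : Algorithm)

/-- The event that the algorithm is still running after `k` inputs. -/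
def running (k : ℕ) : Set (ℕ → Bool × ℝ) := {ω | (k : ℕ∞) < B.stopTime ω}

/-- The event that the algorithm has stopped within `m` inputs with output `1`. -/
def accepted (m : ℕ) : Set (ℕ → Bool × ℝ) := {ω | B.output ω = true} \ B.running m

lemma running_eq (k : ℕ) :
    B.running k = ⋂ j ∈ Set.Icc 1 k, {ω | B.tau j (initial ω j) = true}ᶜ := by
  ext ω
  simp only [running, Set.mem_ofPred_eq, Set.mem_iInter, Set.mem_Icc, Set.mem_compl_iff]
  constructor
  · intro h j hj ht
    have : B.stopTime ω ≤ j := iInf₂_le j ⟨hj.1, ht⟩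
    exact absurd (h.trans_le this) (by simpa using hj.2)
  · intro h
    refine (ENat.natCast_lt_natCast.2 k.lt_succ_self).trans_le (le_iInf₂ fun j hj => ?_)
    by_contra hlt
    have : j < k + 1 := ENat.natCast_lt_natCast.1 (not_le.1 hlt)
    exact h j ⟨hj.1, by omega⟩ hj.2

lemma measurableSet_running (k : ℕ) : MeasurableSet[past k] (B.running k) := by
  let _ := past k
  rw [running_eq]
  refine MeasurableSet.biInter (Set.to_countable _) fun j hj => MeasurableSet.compl ?_
  exact ((B.measurable_tau j).comp (measurable_past_initial hj.2)) (measurableSet_singleton true)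

lemma running_anti {j k : ℕ} (h : j ≤ k) : B.running k ⊆ B.running j :=
  fun _ hω => (ENat.natCast_le_natCast.2 h).trans_lt hω

lemma measurableSet_stopTime_eq (j : ℕ) : MeasurableSet[past j] {ω | B.stopTime ω = j} := by
  let _ := past j
  have h : {ω | B.stopTime ω = j} = (B.running j)ᶜ ∩ ⋂ i ∈ Set.Iio j, B.running i := by
    ext ω
    simp only [running, Set.mem_ofPred_eq, Set.mem_inter_iff, Set.mem_compl_iff, not_lt,
      Set.mem_iInter, Set.mem_Iio]
    constructor
    · intro h
      exact ⟨h.le, fun i hi => h ▸ ENat.natCast_lt_natCast.2 hi⟩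
    · rintro ⟨h1, h2⟩
      obtain ⟨n, hn⟩ := ENat.ne_top_iff_exists.1 (ne_top_of_le_ne_top (ENat.natCast_ne_top j) h1)
      rw [← hn] at h1 h2 ⊢
      refine h1.antisymm (not_lt.1 fun hlt => ?_)
      exact lt_irrefl _ (h2 n (by simpa using hlt))
  rw [h]
  refine (B.measurableSet_running j).compl.inter
    (MeasurableSet.biInter (Set.to_countable _) fun i hi => ?_)
  exact past_mono hi.le _ (B.measurableSet_running i)

lemma measurableSet_accepted (m : ℕ) : MeasurableSet[past m] (B.accepted m) := by
  let _ := past m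
  have h : B.accepted m = ⋃ j ∈ Set.Iic m, {ω | B.stopTime ω = j} ∩
      (fun ω => B.gamma j (initial ω j)) ⁻¹' {true} := by
    ext ω
    simp only [accepted, running, output, Set.mem_sdiff, Set.mem_ofPred_eq, not_lt, Set.mem_iUnion,
      Set.mem_Iic, Set.mem_inter_iff, Set.mem_preimage, Set.mem_singleton_iff, exists_prop]
    constructor
    · rintro ⟨h1, h2⟩
      -- Stopping within m inputs makes N finite, so the default value of `toNat` at `⊤` plays no
      -- role.
      obtain ⟨n, hn⟩ := ENat.ne_top_iff_exists.1 (ne_top_of_le_ne_top (ENat.natCast_ne_top m) h2)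
      rw [← hn] at h1 h2
      exact ⟨n, by simpa using h2, hn.symm, by simpa using h1⟩
    · rintro ⟨j, hj, h1, h2⟩
      rw [h1]
      exact ⟨by simpa using h2, by simpa using hj⟩
  rw [h]
  refine MeasurableSet.biUnion (Set.to_countable _) fun j hj => ?_
  refine (past_mono hj _ (B.measurableSet_stopTime_eq j)).inter ?_
  exact ((B.measurable_gamma j).comp (measurable_past_initial hj)) (measurableSet_singleton true)

/-- This verifies the hypothesis `hEA` of the sequential bound: once stopped, acceptance is decided
by the inputs already read. -/
lemma accepted_diff_running {k m : ℕ} (h : k ≤ m) :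
    B.accepted m \ B.running k = B.accepted k := by
  ext ω
  simp only [accepted, Set.mem_sdiff]
  exact ⟨fun hω => ⟨hω.1.1, hω.2⟩, fun hω => ⟨⟨hω.1, fun h' => hω.2 (B.running_anti h h')⟩, hω.2⟩⟩

lemma abs_real_output_sub_real_accepted_le (p : I) (m : ℕ) :
    |(inputLaw p).real {ω | B.output ω = true} - (inputLaw p).real (B.accepted m)| ≤
      (inputLaw p).real (B.running m) := by
  have h1 : (inputLaw p).real (B.accepted m) ≤ (inputLaw p).real {ω | B.output ω = true} :=
    measureReal_mono Set.sdiff_subset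
  have h2 : (inputLaw p).real {ω | B.output ω = true} ≤
      (inputLaw p).real (B.accepted m) + (inputLaw p).real (B.running m) :=
    (measureReal_mono (by rw [accepted, Set.sdiff_union_self]; exact Set.subset_union_left)).trans
      (measureReal_union_le _ _)
  rw [abs_of_nonneg (sub_nonneg.2 h1)]
  linarith

/-- Still running at time m is an event of the first m inputs, so its probability changes by at most
the largest likelihood ratio. -/
lemma real_running_le (p q : I) (hp : (p : ℝ) ∈ Set.Ioo (0 : ℝ) 1) (hpq : p ≤ q) (m : ℕ) :
    (inputLaw q).real (B.running m) ≤ ((q : ℝ) / p) ^ m * (inputLaw p).real (B.running m) := by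
  rw [inputLaw_real_eq_integral p q hp m (B.measurableSet_running m), mul_comm]
  have h : ∫ _ω in B.running m, ((q : ℝ) / p) ^ m ∂inputLaw p =
      (inputLaw p).real (B.running m) * ((q : ℝ) / p) ^ m := by
    rw [setIntegral_const, smul_eq_mul]
  rw [← h]
  exact integral_mono ((isBoundedAt_likelihood p q m).integrable p).integrableOn
    (integrable_const _) fun ω => likelihood_le p q hp hpq le_rfl ω

/-- The tail-sum formula for E[N], truncated: pointwise, the sum of the indicators of k < N over k <
m is min(N, m). -/
lemma sum_real_running_le (p : I) (h : B.meanInputs p ≠ ∞) (m : ℕ) :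
    ∑ k ∈ Finset.range m, (inputLaw p).real (B.running k) ≤ (B.meanInputs p).toReal := by
  have hm : ∀ k, MeasurableSet (B.running k) := fun k => past_le k _ (B.measurableSet_running k)
  have hle : ∑ k ∈ Finset.range m, inputLaw p (B.running k) ≤ B.meanInputs p := by
    calc ∑ k ∈ Finset.range m, inputLaw p (B.running k)
        = ∫⁻ ω, ∑ k ∈ Finset.range m, (B.running k).indicator 1 ω ∂inputLaw p := by
          rw [lintegral_finsetSum _ fun k _ => measurable_one.indicator (hm k)]
          simp only [lintegral_indicator_one (hm _)]
      _ ≤ B.meanInputs p := lintegral_mono fun ω => ?_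
    rcases eq_or_ne (B.stopTime ω) ⊤ with ht | ht
    · simp [ht]
    · obtain ⟨n, hn⟩ := ENat.ne_top_iff_exists.1 ht
      have : ∀ k, (B.running k).indicator (1 : (ℕ → Bool × ℝ) → ℝ≥0∞) ω =
          if k < n then 1 else 0 := by
        intro k
        simp [Set.indicator_apply, running, ← hn]
      simp only [this, ← hn, Finset.sum_boole]
      have hc : ((Finset.range m).filter (· < n)).card ≤ n := by
        simpa using Finset.card_le_card
          (show (Finset.range m).filter (· < n) ⊆ Finset.range n by intro x; simp)
      exact_mod_cast hc
  simp only [measureReal_def]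
  rw [← ENNReal.toReal_sum fun _ _ => measure_ne_top _ _]
  exact ENNReal.toReal_mono h hle

end Algorithm

/-! ### Passage to the limit q → p and the final inequality. -/

lemma tendsto_one_add_pow_sq (c : ℝ) :
    Filter.Tendsto (fun m : ℕ => (1 + c * ((m : ℝ) ^ 2)⁻¹) ^ m) Filter.atTop (nhds 1) := by
  have h : Filter.Tendsto (fun m : ℕ => (m : ℝ) * (c * ((m : ℝ) ^ 2)⁻¹)) Filter.atTop (nhds 0) := by
    have h0 := (tendsto_inv_atTop_zero.comp (tendsto_natCast_atTop_atTop (R := ℝ))).const_mul c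
    rw [mul_zero] at h0
    refine h0.congr fun m => ?_
    rcases eq_or_ne (m : ℝ) 0 with hm | hm
    · simp [hm]
    · simp only [Function.comp_apply]; field_simp
  simpa using Real.tendsto_one_add_pow_exp_of_tendsto h

/-- The information inequality for Bernoulli factories, in square root form. -/
theorem abs_deriv_le (S : Set ℝ) (hS : IsOpen S) (f : ℝ → ℝ) (hf : DifferentiableOn ℝ f S)
    (B : Algorithm) (hB : B.IsFactory S f) (hfast : B.IsFast S) (p : I) (hp : (p : ℝ) ∈ S)
    (hp01 : (p : ℝ) ∈ Set.Ioo (0 : ℝ) 1) (hN : B.meanInputs p ≠ ∞) :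
    |deriv f p| ≤
      √((B.meanInputs p).toReal / (p * (1 - p)) * (f p * (1 - f p))) := by
  obtain ⟨A, β, hA, hβ1, htail⟩ := hfast p hp
  have hβ0 : 0 ≤ β := by
    have := measureReal_nonneg.trans (htail 1)
    rw [pow_one] at this
    exact nonneg_of_mul_nonneg_right this hA
  set T := (B.meanInputs p).toReal
  have hp1 : 0 < (p : ℝ) := hp01.1
  have hp2 : 0 < 1 - (p : ℝ) := sub_pos.2 hp01.2
  -- The increment must be o(1/m) for `K m` to tend to 1, yet decay more slowly than β^m so that the
  -- truncation error divided by it vanishes.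
  set t : ℕ → ℝ := fun m => ((m : ℝ) ^ 2)⁻¹ with ht
  set K : ℕ → ℝ := fun m => (1 + (p : ℝ)⁻¹ * t m) ^ m with hK
  set e : ℕ → ℝ := fun m => (inputLaw p).real (B.accepted m) with he
  have hK1 : Filter.Tendsto K Filter.atTop (nhds 1) := tendsto_one_add_pow_sq _
  have htpos : ∀ᶠ m in Filter.atTop, 0 < t m := by
    filter_upwards [Filter.eventually_gt_atTop 0] with m hm
    simp only [ht]; positivity
  have ht0 : Filter.Tendsto t Filter.atTop (nhds 0) :=
    ((Filter.tendsto_pow_atTop two_ne_zero).comp tendsto_natCast_atTop_atTop).inv_tendsto_atTop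
  have hd : Filter.Tendsto (fun m => (t m)⁻¹ * (f (p + t m) - f p)) Filter.atTop
      (nhds (deriv f p)) :=
    ((hf.differentiableAt (hS.mem_nhds hp)).hasDerivAt.tendsto_slope_zero_right).comp
      (tendsto_nhdsWithin_iff.2 ⟨ht0, htpos⟩)
  have hβt : Filter.Tendsto (fun m : ℕ => A * β ^ m) Filter.atTop (nhds 0) := by
    simpa using (tendsto_pow_atTop_nhds_zero_of_lt_one hβ0 hβ1).const_mul A
  have hβt2 : Filter.Tendsto (fun m : ℕ => (m : ℝ) ^ 2 * β ^ m) Filter.atTop (nhds 0) :=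
    tendsto_pow_const_mul_const_pow_of_lt_one 2 hβ0 hβ1
  have hepos : Filter.Tendsto e Filter.atTop (nhds (f p)) := by
    refine tendsto_iff_norm_sub_tendsto_zero.2 (squeeze_zero (fun _ => norm_nonneg _) ?_ hβt)
    intro m
    have := B.abs_real_output_sub_real_accepted_le p m
    rw [(hB p hp).2, abs_sub_comm] at this
    exact this.trans (htail m)
  have hmem : ∀ᶠ m in Filter.atTop, (p : ℝ) + t m ∈ S ∩ Set.Ioo (0 : ℝ) 1 := by
    have h : Filter.Tendsto (fun m => (p : ℝ) + t m) Filter.atTop (nhds p) := by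
      simpa using ht0.const_add (p : ℝ)
    exact h.eventually ((hS.inter isOpen_Ioo).mem_nhds ⟨hp, hp01⟩)
  have hbound : ∀ᶠ m in Filter.atTop, |(t m)⁻¹ * (f (p + t m) - f p)| ≤
      √(T / (p * (1 - p)) * K m ^ 2 * (e m * (1 - e m))) +
        (K m + 1) * (A * ((m : ℝ) ^ 2 * β ^ m)) := by
    filter_upwards [htpos, hmem] with m htm hm
    let q : I := ⟨p + t m, hm.2.1.le, hm.2.2.le⟩
    have hq : (q : ℝ) = p + t m := rfl
    have hpq : p ≤ q := by
      change (p : ℝ) ≤ q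
      rw [hq]; linarith
    have hKq : ((q : ℝ) / p) ^ m = K m := by
      simp only [hK, hq]; congr 1; field_simp
    have hK0 : 0 ≤ K m := by rw [← hKq]; exact pow_nonneg (div_nonneg q.2.1 hp1.le) m
    have h1 := sq_real_sub_real_le hp01 hpq B.measurableSet_running (B.measurableSet_accepted m)
      fun k hk => by rw [B.accepted_diff_running hk.le]; exact B.measurableSet_accepted k
    have h2 := B.abs_real_output_sub_real_accepted_le p m
    have h3 := B.abs_real_output_sub_real_accepted_le q m
    have h4 := B.real_running_le p q hp01 hpq m
    rw [(hB p hp).2] at h2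
    rw [(hB q hm.1).2] at h3
    rw [hKq] at h1 h4
    have htl : (inputLaw p).real (B.running m) ≤ A * β ^ m := htail m
    have hsum := B.sum_real_running_le p hN m
    have hsq : |(inputLaw q).real (B.accepted m) - e m| ≤
        t m * √(T / (p * (1 - p)) * K m ^ 2 * (e m * (1 - e m))) := by
      rw [← Real.sqrt_sq_eq_abs, ← Real.sqrt_sq htm.le, ← Real.sqrt_mul (sq_nonneg _)]
      refine Real.sqrt_le_sqrt (h1.trans ?_)
      have hee : 0 ≤ e m * (1 - e m) :=
        mul_nonneg measureReal_nonneg (sub_nonneg.2 measureReal_le_one)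
      calc _ ≤ ((q : ℝ) - p) ^ 2 / (p * (1 - p)) * K m ^ 2 * T * (e m * (1 - e m)) := by
            refine mul_le_mul_of_nonneg_right (mul_le_mul_of_nonneg_left hsum ?_) hee
            positivity
        _ = _ := by rw [hq]; ring
    have htri : |f (p + t m) - f p| ≤
        t m * √(T / (p * (1 - p)) * K m ^ 2 * (e m * (1 - e m))) + (K m + 1) * (A * β ^ m) := by
      -- The outer differences are truncation errors at q and at p; the middle one is bounded by
      -- `hsq`.
      have e1 : f (p + t m) - f p = (f q - (inputLaw q).real (B.accepted m)) +
          ((inputLaw q).real (B.accepted m) - e m) - (f p - e m) := by rw [hq]; ring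
      rw [e1]
      refine (abs_sub _ _).trans ((add_le_add_left (abs_add_le _ _) _).trans ?_)
      nlinarith [mul_le_mul_of_nonneg_left htl hK0]
    rw [abs_mul, abs_of_pos (inv_pos.2 htm)]
    refine (mul_le_mul_of_nonneg_left htri (inv_pos.2 htm).le).trans_eq ?_
    rw [mul_add, inv_mul_cancel_left₀ htm.ne']
    simp only [ht, inv_inv]
    ring
  have hlim : Filter.Tendsto (fun m => √(T / (p * (1 - p)) * K m ^ 2 * (e m * (1 - e m))) +
        (K m + 1) * (A * ((m : ℝ) ^ 2 * β ^ m))) Filter.atTop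
      (nhds (√(T / (p * (1 - p)) * 1 ^ 2 * (f p * (1 - f p))) + (1 + 1) * (A * 0))) :=
    (((hK1.pow 2).const_mul _).mul (hepos.mul (hepos.const_sub 1))).sqrt.add
      ((hK1.add_const 1).mul (hβt2.const_mul A))
  have := le_of_tendsto_of_tendsto hd.abs hlim hbound
  simpa using this

end BernoulliFactory

theorem mainTheorem3 (S : Set ℝ) (hS : IsOpen S) (hS01 : S ⊆ Set.Ioo (0 : ℝ) 1)
    (f : ℝ → ℝ) (hf01 : ∀ p ∈ S, f p ∈ Set.Ioo (0 : ℝ) 1) (hf : DifferentiableOn ℝ f S)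
    (B : BernoulliFactory.Algorithm) (hB : B.IsFactory S f) (hfast : B.IsFast S)
    (p : unitInterval) (hp : (p : ℝ) ∈ S) :
    ENNReal.ofReal
        ((deriv f (p : ℝ)) ^ 2 * ((p : ℝ) * (1 - (p : ℝ)) / (f p * (1 - f p))))
      ≤ B.meanInputs p := by
  -- The infinite case is trivial, so finiteness of E[N] need not be derived from the exponential
  -- tail.
  by_cases hN : B.meanInputs p = ∞
  · simp [hN]
  have hp1 : 0 < (p : ℝ) := (hS01 hp).1
  have hp2 : 0 < 1 - (p : ℝ) := sub_pos.2 (hS01 hp).2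
  have hf1 : 0 < f p := (hf01 p hp).1
  have hf2 : 0 < 1 - f p := sub_pos.2 (hf01 p hp).2
  have h := BernoulliFactory.abs_deriv_le S hS f hf B hB hfast p hp (hS01 hp) hN
  have h2 : deriv f p ^ 2 ≤ (B.meanInputs p).toReal / (p * (1 - p)) * (f p * (1 - f p)) := by
    rw [← sq_abs, ← Real.sq_sqrt (show 0 ≤ (B.meanInputs p).toReal / (p * (1 - p)) *
      (f p * (1 - f p)) by positivity)]
    gcongr
  refine ENNReal.ofReal_le_of_le_toReal ?_
  calc _ ≤ (B.meanInputs p).toReal / (p * (1 - p)) * (f p * (1 - f p)) *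
        (p * (1 - p) / (f p * (1 - f p))) := by gcongr
    _ = _ := by field_simp
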